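/- Let $N\in\{1,2,\dots\}$, $\alpha\in(0,N)$ with $\alpha>N-2$, let $V\in C(\mathbb R^N;[0,\infty))$, let $a_*\in\mathbb R^N$, and suppose that $$V(x)=o\big(|x-a_*|^{\frac{4}{\alpha+2-N}-2}\big)\qquad\text{as }x\to a_*.$$ Let $I_\alpha(x)=\dfrac{\Gamma(\frac{N-\alpha}{2})}{\Gamma(\frac{\alpha}{2})\,\pi^{N/2}\,2^{\alpha}\,|x|^{N-\alpha}}$ be the Riesz potential, let $\varepsilon_0>0$, and let $(u_\varepsilon)_{\varepsilon\in(0,\varepsilon_0)}$ be a family of functions in $H^1_{\mathrm{loc}}(\mathbb R^N)\cap L^2\big((1+|x|)^{-(N-\alpha)}\,dx\big)$ such that each $u_\varepsilon$ is positive almost everywhere and is a weak solution of $$-\varepsilon^2\Delta u_\varepsilon+Vu_\varepsilon=\varepsilon^{-\alpha}\big(I_\alpha*|u_\varepsilon|^2\big)u_\varepsilon\quad\text{in }\mathbb R^N,$$ that is, $I_\alpha*|u_\varepsilon|^2$ is finite almost everywhere, $(I_\alpha*|u_\varepsilon|^2)u_\varepsilon\in L^1_{\mathrm{loc}}(\mathbb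 R^N)$, and for every $\varphi\in C^\infty_c(\mathbb R^N)$ $$\int_{\mathbb R^N}\varepsilon^2\,\nabla u_\varepsilon\cdot\nabla\varphi+Vu_\varepsilon\varphi=\varepsilon^{-\alpha}\int_{\mathbb R^N}\big(I_\alpha*|u_\varepsilon|^2\big)u_\varepsilon\,\varphi .$$ Then for every compact set $K\subset\mathbb R^N\setminus\{a_*\}$, as $\varepsilon\to0^+$, $$\int_K|u_\varepsilon|^2=o(\varepsilon^N).$$ -/

import Mathlib

open MeasureTheory Set Filter Topology Asymptotics
open scoped ContDiff Gradient

noncomputable section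

namespace Choquard

/-- The Riesz potential `I_α` on `ℝ^N`,
`I_α(x) = Γ((N - α)/2) / (Γ(α/2) π^{N/2} 2^α |x|^{N - α})` for `x ≠ 0`
(the value at the single point `0` plays no role). -/
def rieszPotential (N : ℕ) (α : ℝ) (x : EuclideanSpace ℝ (Fin N)) : ℝ :=
  Real.Gamma (((N : ℝ) - α) / 2) /
    (Real.Gamma (α / 2) * Real.pi ^ ((N : ℝ) / 2) * (2 : ℝ) ^ α * ‖x‖ ^ ((N : ℝ) - α))

/-- The convolution `I_α ∗ |u|^p` on `ℝ^N`. -/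
def rieszConv (N : ℕ) (α p : ℝ) (u : EuclideanSpace ℝ (Fin N) → ℝ) :
    EuclideanSpace ℝ (Fin N) → ℝ :=
  convolution (rieszPotential N α) (fun y => |u y| ^ p) (ContinuousLinearMap.lsmul ℝ ℝ) volume

/-- `f ∈ L²_loc(ℝ^N)`. -/
def MemL2loc {N : ℕ} {F : Type*} [NormedAddCommGroup F] (f : EuclideanSpace ℝ (Fin N) → F) :
    Prop :=
  ∀ K : Set (EuclideanSpace ℝ (Fin N)), IsCompact K → MemLp f 2 (volume.restrict K)

/-- `φ ∈ C^∞_c(ℝ^N)`. -/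
def IsTestFunction {N : ℕ} (φ : EuclideanSpace ℝ (Fin N) → ℝ) : Prop :=
  ContDiff ℝ ∞ φ ∧ HasCompactSupport φ

/-- `g` is the weak gradient of `u`, for `u` and `g` in `L²_loc(ℝ^N)`. -/
def HasWeakGradient {N : ℕ} (u : EuclideanSpace ℝ (Fin N) → ℝ)
    (g : EuclideanSpace ℝ (Fin N) → EuclideanSpace ℝ (Fin N)) : Prop :=
  MemL2loc u ∧ MemL2loc g ∧
    ∀ φ : EuclideanSpace ℝ (Fin N) → ℝ, IsTestFunction φ →
      ∫ x, u x • ∇ φ x = - ∫ x, φ x • g x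

/-- `u ∈ H¹_loc(ℝ^N)`: `u` is in `L²_loc` and has a weak gradient in `L²_loc`. -/
def MemH1loc {N : ℕ} (u : EuclideanSpace ℝ (Fin N) → ℝ) : Prop :=
  ∃ g : EuclideanSpace ℝ (Fin N) → EuclideanSpace ℝ (Fin N), HasWeakGradient u g

/-- `u ∈ L²((1 + |x|)^{-(N - α)} dx)`. -/
def MemWeightedL2 {N : ℕ} (α : ℝ) (u : EuclideanSpace ℝ (Fin N) → ℝ) : Prop :=
  MemLp u 2 ((volume : Measure (EuclideanSpace ℝ (Fin N))).withDensity
    (fun x => ENNReal.ofReal ((1 + ‖x‖) ^ (-((N : ℝ) - α)))))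

/-- `u ∈ H¹_loc(ℝ^N)` is a weak solution of the Choquard equation
`-ε² Δu + V u = ε^{-α} (I_α ∗ |u|^p) |u|^{p-2} u` in `ℝ^N`. The convolution has to exist almost
everywhere and the nonlinear term has to be locally integrable, so that the equation makes sense
against test functions. -/
def IsWeakSolution {N : ℕ} (V : EuclideanSpace ℝ (Fin N) → ℝ) (α p ε : ℝ)
    (u : EuclideanSpace ℝ (Fin N) → ℝ) : Prop :=
  (∀ᵐ x, ConvolutionExistsAt (rieszPotential N α) (fun y => |u y| ^ p) x
    (ContinuousLinearMap.lsmul ℝ ℝ) volume) ∧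
  LocallyIntegrable (fun x => rieszConv N α p u x * (|u x| ^ (p - 2) * u x)) ∧
  ∃ g : EuclideanSpace ℝ (Fin N) → EuclideanSpace ℝ (Fin N), HasWeakGradient u g ∧
    ∀ φ : EuclideanSpace ℝ (Fin N) → ℝ, IsTestFunction φ →
      ∫ x, (ε ^ 2 * inner ℝ (g x) (∇ φ x) + V x * u x * φ x) =
        ε ^ (-α) * ∫ x, rieszConv N α p u x * (|u x| ^ (p - 2) * u x) * φ x

end Choquard

end

/-!
Write `S = ∫_K |u_ε|²`. The argument compares the nonlocal potential `I_α ∗ |u_ε|²` near `a` with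
what a positive solution tolerates there.

* Near `a` the vectors `x - y`, `y ∈ K`, stay bounded and away from `0`, so `I_α ∗ |u_ε|² ≥ c S` on a
  fixed ball about `a`, with `c > 0` depending only on `K` and `a`
  (`Choquard.mul_setIntegral_le_rieszConv`).
* The bump `φ(x) = exp(-1 / (1 - |x - a|² / δ²))` satisfies `-Δφ ≤ λ δ⁻² φ` on all of `ℝ^N`, with `λ`
  depending only on `N` (`Choquard.neg_divGradient_bump_le`). Testing the equation against it, with
  both derivatives moved onto `φ`, and dividing by `∫ u_ε φ > 0` gives
  `ε^{-α} c S ≤ λ ε² / δ² + sup_{B(a, δ)} V` (`Choquard.IsWeakSolution.mul_le_of_forall_le`). Thus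
  `φ` plays the part of the first Dirichlet eigenfunction of a ball, but no regularity of `u_ε` up to
  the boundary of the ball and no quotient `φ² / u_ε` is needed.
* With `δ = M ε^{(α + 2 - N) / 2}` and `V = o(|x - a|^{4 / (α + 2 - N) - 2})` both terms on the right
  are multiples of `ε^{N - α}`, namely `λ M⁻² ε^{N - α}` and `o(1) M^{4 / (α + 2 - N) - 2} ε^{N - α}`.
  Hence `limsup ε^{-N} S ≤ λ / (c M²)` for every `M`, and `M` is arbitrary.
-/

namespace Choquard

open Polynomial

variable {N : ℕ}

/-! ### Test functions and weak gradients -/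

lemma gradient_apply (φ : EuclideanSpace ℝ (Fin N) → ℝ) (x : EuclideanSpace ℝ (Fin N))
    (i : Fin N) : ∇ φ x i = fderiv ℝ φ x (EuclideanSpace.single i 1) := by
  rw [← inner_gradient_left, PiLp.inner_apply]
  simp

lemma IsTestFunction.gradient_apply {φ : EuclideanSpace ℝ (Fin N) → ℝ} (hφ : IsTestFunction φ)
    (i : Fin N) : IsTestFunction (fun x => ∇ φ x i) := by
  simp_rw [Choquard.gradient_apply]
  exact ⟨(hφ.1.fderiv_right (by simp)).clm_apply contDiff_const, hφ.2.fderiv_apply ℝ _⟩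

lemma MemL2loc.locallyIntegrable {F : Type*} [NormedAddCommGroup F]
    {f : EuclideanSpace ℝ (Fin N) → F} (hf : MemL2loc f) : LocallyIntegrable f := by
  rw [locallyIntegrable_iff]
  intro K hK
  have : IsFiniteMeasure (volume.restrict K) := isFiniteMeasure_restrict.2 hK.measure_lt_top.ne
  exact (hf K hK).integrable (by norm_num)

lemma MemL2loc.apply {f : EuclideanSpace ℝ (Fin N) → EuclideanSpace ℝ (Fin N)}
    (hf : MemL2loc f) (i : Fin N) : MemL2loc (fun x => f x i) := fun K hK =>
  (EuclideanSpace.proj i : EuclideanSpace ℝ (Fin N) →L[ℝ] ℝ).comp_memLp' (hf K hK)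

lemma integrable_inner_gradient {g : EuclideanSpace ℝ (Fin N) → EuclideanSpace ℝ (Fin N)}
    (hg : MemL2loc g) {φ : EuclideanSpace ℝ (Fin N) → ℝ} (hφ : IsTestFunction φ) :
    Integrable (fun x => inner ℝ (g x) (∇ φ x)) := by
  simp only [PiLp.inner_apply]
  refine integrable_finsetSum _ fun i _ => ?_
  simpa using (hg.apply i).locallyIntegrable.integrable_smul_left_of_hasCompactSupport
    (hφ.gradient_apply i).1.continuous (hφ.gradient_apply i).2

/-- The Laplacian of `φ`, as the divergence `∑ᵢ ∂ᵢ ∂ᵢ φ` of its gradient. -/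
noncomputable def divGradient (φ : EuclideanSpace ℝ (Fin N) → ℝ)
    (x : EuclideanSpace ℝ (Fin N)) : ℝ :=
  ∑ i, ∇ (fun y => ∇ φ y i) x i

lemma integrable_mul_divGradient {u : EuclideanSpace ℝ (Fin N) → ℝ}
    (hu : MemL2loc u) {φ : EuclideanSpace ℝ (Fin N) → ℝ} (hφ : IsTestFunction φ) :
    Integrable (fun x => u x * divGradient φ x) := by
  simp only [divGradient, Finset.mul_sum]
  exact integrable_finsetSum _ fun i _ =>
    hu.locallyIntegrable.integrable_smul_right_of_hasCompactSupport
      ((hφ.gradient_apply i).gradient_apply i).1.continuous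
      ((hφ.gradient_apply i).gradient_apply i).2

/-- Integration by parts puts both derivatives on the test function: the identity defining the weak
gradient is applied to each partial derivative of `φ`, which is again a test function. -/
lemma HasWeakGradient.integral_inner_gradient {u : EuclideanSpace ℝ (Fin N) → ℝ}
    {g : EuclideanSpace ℝ (Fin N) → EuclideanSpace ℝ (Fin N)} (h : HasWeakGradient u g)
    {φ : EuclideanSpace ℝ (Fin N) → ℝ} (hφ : IsTestFunction φ) :
    ∫ x, inner ℝ (g x) (∇ φ x) = -∫ x, u x * divGradient φ x := by
  obtain ⟨hu, hg, h⟩ := h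
  have hI (i : Fin N) : Integrable (fun x => ∇ φ x i * g x i) :=
    (hg.apply i).locallyIntegrable.integrable_smul_left_of_hasCompactSupport
      (hφ.gradient_apply i).1.continuous (hφ.gradient_apply i).2
  have hJ (i : Fin N) : Integrable (fun x => u x * ∇ (fun y => ∇ φ y i) x i) :=
    hu.locallyIntegrable.integrable_smul_right_of_hasCompactSupport
      ((hφ.gradient_apply i).gradient_apply i).1.continuous
      ((hφ.gradient_apply i).gradient_apply i).2
  have key (i : Fin N) :
      ∫ x, u x * ∇ (fun y => ∇ φ y i) x i = -∫ x, ∇ φ x i * g x i := by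
    have hψ := hφ.gradient_apply i
    have hL : Integrable (fun x => u x • ∇ (fun y => ∇ φ y i) x) := by
      refine hu.locallyIntegrable.integrable_smul_right_of_hasCompactSupport ?_ ?_
      · exact (InnerProductSpace.toDual ℝ _).symm.continuous.comp
          (hψ.1.continuous_fderiv (by simp))
      · exact (hψ.2.fderiv ℝ).comp_left (map_zero _)
    have hR : Integrable (fun x => ∇ φ x i • g x) :=
      hg.locallyIntegrable.integrable_smul_left_of_hasCompactSupport hψ.1.continuous hψ.2
    have := congrArg (EuclideanSpace.proj i : EuclideanSpace ℝ (Fin N) →L[ℝ] ℝ) (h _ hψ)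
    rw [map_neg, ← ContinuousLinearMap.integral_comp_comm _ hL,
      ← ContinuousLinearMap.integral_comp_comm _ hR] at this
    simpa using this
  calc ∫ x, inner ℝ (g x) (∇ φ x) = ∫ x, ∑ i, ∇ φ x i * g x i := by
        simp only [PiLp.inner_apply, RCLike.inner_apply, conj_trivial]
    _ = ∑ i, ∫ x, ∇ φ x i * g x i := integral_finsetSum _ fun i _ => hI i
    _ = -∑ i, ∫ x, u x * ∇ (fun y => ∇ φ y i) x i := by simp [key]
    _ = -∫ x, u x * divGradient φ x := by
        simp only [divGradient, Finset.mul_sum]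
        rw [integral_finsetSum _ fun i _ => hJ i]

/-! ### A bump function with `-Δφ ≤ λ φ` -/

/-- With `s = 1 - |x - a|² / δ²`, the function `p(1/s) e^{-1/s}` where `s > 0`, extended by `0`.
These are the radial profiles of the derivatives of `bump`. -/
noncomputable def bumpAux (a : EuclideanSpace ℝ (Fin N)) (δ : ℝ) (p : ℝ[X])
    (x : EuclideanSpace ℝ (Fin N)) : ℝ :=
  p.eval (1 - ‖x - a‖ ^ 2 / δ ^ 2)⁻¹ * expNegInvGlue (1 - ‖x - a‖ ^ 2 / δ ^ 2)

/-- The standard bump `exp(-1 / (1 - |x - a|² / δ²))` supported in the closed ball of radius `δ`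
about `a`. -/
noncomputable def bump (a : EuclideanSpace ℝ (Fin N)) (δ : ℝ) (x : EuclideanSpace ℝ (Fin N)) : ℝ :=
  expNegInvGlue (1 - ‖x - a‖ ^ 2 / δ ^ 2)

lemma bump_nonneg (a : EuclideanSpace ℝ (Fin N)) (δ : ℝ) (x : EuclideanSpace ℝ (Fin N)) :
    0 ≤ bump a δ x := expNegInvGlue.nonneg _

lemma bump_pos {a : EuclideanSpace ℝ (Fin N)} {δ : ℝ} {x : EuclideanSpace ℝ (Fin N)}
    (hx : x ∈ Metric.ball a δ) : 0 < bump a δ x := by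
  rw [mem_ball_iff_norm] at hx
  have hδ : 0 < δ := (norm_nonneg _).trans_lt hx
  refine expNegInvGlue.pos_of_pos (sub_pos.2 ((div_lt_one (by positivity)).2 ?_))
  gcongr

lemma bump_eq_zero {a : EuclideanSpace ℝ (Fin N)} {δ : ℝ} (hδ : 0 < δ)
    {x : EuclideanSpace ℝ (Fin N)} (hx : x ∉ Metric.ball a δ) : bump a δ x = 0 := by
  rw [mem_ball_iff_norm, not_lt] at hx
  refine expNegInvGlue.zero_of_nonpos (sub_nonpos.2 ((one_le_div (by positivity)).2 ?_))
  gcongr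

lemma isTestFunction_bump (a : EuclideanSpace ℝ (Fin N)) {δ : ℝ} (hδ : 0 < δ) :
    IsTestFunction (bump a δ) := by
  refine ⟨?_, HasCompactSupport.intro (isCompact_closedBall a δ) fun x hx =>
    bump_eq_zero hδ fun h => hx (Metric.ball_subset_closedBall h)⟩
  refine expNegInvGlue.contDiff.comp (contDiff_const.sub (ContDiff.div_const ?_ _))
  exact (contDiff_id.sub contDiff_const).norm_sq ℝ

lemma hasGradientAt_bumpAux (a : EuclideanSpace ℝ (Fin N)) (δ : ℝ) (p : ℝ[X])
    (x : EuclideanSpace ℝ (Fin N)) :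
    HasGradientAt (bumpAux a δ p)
      ((-2 / δ ^ 2 * bumpAux a δ (X ^ 2 * (p - derivative p)) x) • (x - a)) x := by
  have h1 : HasFDerivAt (fun y => 1 - ‖y - a‖ ^ 2 / δ ^ 2)
      (-((δ ^ 2)⁻¹ • (2 • innerSL ℝ (x - a)))) x := by
    have := (((hasFDerivAt_id x).sub_const a).norm_sq.mul_const ((δ ^ 2)⁻¹)).const_sub 1
    simpa [div_eq_mul_inv] using this
  have h2 := (expNegInvGlue.hasDerivAt_polynomial_eval_inv_mul p
    (1 - ‖x - a‖ ^ 2 / δ ^ 2)).comp_hasFDerivAt x h1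
  rw [hasGradientAt_iff_hasFDerivAt]
  refine h2.congr_fderiv ?_
  ext v
  simp [bumpAux]
  ring

lemma bump_eq_bumpAux (a : EuclideanSpace ℝ (Fin N)) (δ : ℝ) : bump a δ = bumpAux a δ 1 := by
  ext x
  simp [bump, bumpAux]

lemma divGradient_bump (a : EuclideanSpace ℝ (Fin N)) (δ : ℝ) (x : EuclideanSpace ℝ (Fin N)) :
    divGradient (bump a δ) x = -2 * N / δ ^ 2 * bumpAux a δ (X ^ 2) x +
      4 / δ ^ 4 * ‖x - a‖ ^ 2 * bumpAux a δ (X ^ 4 - 2 * X ^ 3) x := by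
  have h1 (i : Fin N) (y : EuclideanSpace ℝ (Fin N)) :
      ∇ (bump a δ) y i = -2 / δ ^ 2 * bumpAux a δ (X ^ 2) y * (y i - a i) := by
    rw [bump_eq_bumpAux, (hasGradientAt_bumpAux a δ 1 y).gradient]
    simp
  have hp : (X ^ 2 * (X ^ 2 - derivative (X ^ 2)) : ℝ[X]) = X ^ 4 - 2 * X ^ 3 := by
    rw [derivative_X_pow]
    simp only [Nat.cast_ofNat, map_ofNat]
    ring
  have h2 (i : Fin N) : ∇ (fun y => ∇ (bump a δ) y i) x i =
      -2 / δ ^ 2 * bumpAux a δ (X ^ 2) x +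
        4 / δ ^ 4 * bumpAux a δ (X ^ 4 - 2 * X ^ 3) x * (x i - a i) ^ 2 := by
    simp_rw [h1]
    have hG := (hasGradientAt_iff_hasFDerivAt.1 (hasGradientAt_bumpAux a δ (X ^ 2) x)).const_mul
      (-2 / δ ^ 2)
    have hi : HasFDerivAt (fun y : EuclideanSpace ℝ (Fin N) => y i - a i)
        (EuclideanSpace.proj i : EuclideanSpace ℝ (Fin N) →L[ℝ] ℝ) x :=
      (EuclideanSpace.proj i : EuclideanSpace ℝ (Fin N) →L[ℝ] ℝ).hasFDerivAt.sub_const _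
    rw [gradient_apply, (hG.fun_mul hi).fderiv, hp]
    simp [PiLp.inner_apply]
    ring
  simp only [divGradient, h2, Finset.sum_add_distrib, ← Finset.mul_sum,
    EuclideanSpace.norm_sq_eq (x - a)]
  simp
  ring

/-- The bump satisfies `-Δφ ≤ λ φ` on the whole space, the boundary of its support included: near
that boundary `e^{-1/s}` is so convex that `Δφ ≥ 0`. -/
lemma neg_divGradient_bump_le (a : EuclideanSpace ℝ (Fin N)) {δ : ℝ} (hδ : 0 < δ)
    (x : EuclideanSpace ℝ (Fin N)) :
    -divGradient (bump a δ) x ≤ ((N : ℝ) + 5) ^ 2 / 2 / δ ^ 2 * bump a δ x := by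
  rw [divGradient_bump]
  simp only [bump, bumpAux]
  set s : ℝ := 1 - ‖x - a‖ ^ 2 / δ ^ 2 with hs
  have hr : ‖x - a‖ ^ 2 = (1 - s) * δ ^ 2 := by
    rw [hs]; field_simp; ring
  rcases le_or_gt s 0 with h0 | h0
  · simp [expNegInvGlue.zero_of_nonpos h0]
  obtain ⟨t, ht, hst⟩ : ∃ t : ℝ, s⁻¹ = t ∧ s * t = 1 := ⟨_, rfl, mul_inv_cancel₀ h0.ne'⟩
  have hF := expNegInvGlue.nonneg s
  set F := expNegInvGlue s
  -- Since `s t = 1`, the left side is a quartic in `t` with leading coefficient `-4`: it is bounded.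
  have hpoly : 2 * N * t ^ 2 - 4 * (1 - s) * (t ^ 4 - 2 * t ^ 3) ≤ ((N : ℝ) + 5) ^ 2 / 2 := by
    have e : 2 * N * t ^ 2 - 4 * (1 - s) * (t ^ 4 - 2 * t ^ 3) =
        2 * N * t ^ 2 - 4 * t ^ 4 + 12 * t ^ 3 - 8 * t ^ 2 := by
      linear_combination 4 * (t ^ 3 - 2 * t ^ 2) * hst
    rw [e]
    nlinarith [sq_nonneg (t * (t - 3)), sq_nonneg (2 * t ^ 2 - (N + 5))]
  rw [hr, ht]
  simp only [eval_pow, eval_X, eval_sub, eval_mul, eval_ofNat]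
  calc _ = (2 * N * t ^ 2 - 4 * (1 - s) * (t ^ 4 - 2 * t ^ 3)) / δ ^ 2 * F := by
        field_simp; ring
    _ ≤ _ := by gcongr

/-! ### The nonlocal potential and the tested equation -/

lemma exists_pos_forall_le_rieszPotential {α : ℝ} (hα : α ∈ Ioo (0 : ℝ) N) {D : ℝ} (hD : 0 < D) :
    ∃ c, 0 < c ∧ ∀ x : EuclideanSpace ℝ (Fin N), x ≠ 0 → ‖x‖ ≤ D → c ≤ rieszPotential N α x := by
  obtain ⟨hα0, hαN⟩ := hα
  have hG1 : 0 < Real.Gamma (((N : ℝ) - α) / 2) := Real.Gamma_pos_of_pos (by linarith)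
  have hG2 : 0 < Real.Gamma (α / 2) := Real.Gamma_pos_of_pos (by linarith)
  have hπ := Real.pi_pos
  refine ⟨Real.Gamma (((N : ℝ) - α) / 2) /
    (Real.Gamma (α / 2) * Real.pi ^ ((N : ℝ) / 2) * (2 : ℝ) ^ α * D ^ ((N : ℝ) - α)),
    by positivity, fun x hx hxD => ?_⟩
  have : 0 < ‖x‖ := norm_pos_iff.2 hx
  unfold rieszPotential
  gcongr

lemma rieszPotential_nonneg {α : ℝ} (hα : α ∈ Ioo (0 : ℝ) N) (x : EuclideanSpace ℝ (Fin N)) :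
    0 ≤ rieszPotential N α x := by
  obtain ⟨hα0, hαN⟩ := hα
  have hG1 : 0 < Real.Gamma (((N : ℝ) - α) / 2) := Real.Gamma_pos_of_pos (by linarith)
  have hG2 : 0 < Real.Gamma (α / 2) := Real.Gamma_pos_of_pos (by linarith)
  have hπ := Real.pi_pos
  unfold rieszPotential
  positivity

/-- If the Riesz kernel is at least `c` on all the vectors `x - y` with `y ∈ K`, the nonlocal
potential at `x` is at least `c` times the mass of `u` in `K`. -/
lemma mul_setIntegral_le_rieszConv {α : ℝ} (hα : α ∈ Ioo (0 : ℝ) N)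
    {u : EuclideanSpace ℝ (Fin N) → ℝ} (hu : MemL2loc u) {K : Set (EuclideanSpace ℝ (Fin N))}
    (hK : IsCompact K) {c : ℝ} {x : EuclideanSpace ℝ (Fin N)}
    (hc : ∀ y ∈ K, c ≤ rieszPotential N α (x - y))
    (hx : ConvolutionExistsAt (rieszPotential N α) (fun y => |u y| ^ (2 : ℝ)) x
      (ContinuousLinearMap.lsmul ℝ ℝ) volume) :
    c * ∫ y in K, |u y| ^ 2 ≤ rieszConv N α 2 u x := by
  have hint : Integrable (K.indicator fun y => c * |u y| ^ 2) := by
    rw [integrable_indicator_iff hK.measurableSet]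
    have := (hu K hK).integrable_sq
    simpa only [sq_abs, IntegrableOn] using this.const_mul c
  calc c * ∫ y in K, |u y| ^ 2 = ∫ y, K.indicator (fun y => c * |u y| ^ 2) y := by
        rw [integral_indicator hK.measurableSet, integral_const_mul]
    _ = ∫ t, K.indicator (fun y => c * |u y| ^ 2) (x - t) :=
        (integral_sub_left_eq_self _ _ x).symm
    _ ≤ rieszConv N α 2 u x := by
        refine integral_mono (hint.comp_sub_left x) hx fun t => ?_
        simp only [ContinuousLinearMap.lsmul_apply, smul_eq_mul, Real.rpow_two]
        by_cases ht : x - t ∈ K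
        · rw [indicator_of_mem ht]
          gcongr
          simpa using hc _ ht
        · rw [indicator_of_notMem ht]
          exact mul_nonneg (rieszPotential_nonneg hα t) (by positivity)

/-- A positive solution cannot see, on a ball of radius `δ`, a nonlocal potential that exceeds `V` by
more than a multiple of `ε² / δ²`: the equation is tested against `bump a δ`. -/
lemma IsWeakSolution.mul_le_of_forall_le (hN : 1 ≤ N) {V : EuclideanSpace ℝ (Fin N) → ℝ}
    (hV : Continuous V) {α ε : ℝ} (hε : 0 < ε) {u : EuclideanSpace ℝ (Fin N) → ℝ}
    (hu : IsWeakSolution V α 2 ε u) (hpos : ∀ᵐ x, 0 < u x) {a : EuclideanSpace ℝ (Fin N)}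
    {δ m v : ℝ} (hδ : 0 < δ)
    (hm : ∀ᵐ x, x ∈ Metric.ball a δ → m ≤ rieszConv N α 2 u x)
    (hv : ∀ x ∈ Metric.ball a δ, x ≠ a → V x ≤ v) :
    ε ^ (-α) * m ≤ ((N : ℝ) + 5) ^ 2 / 2 * ε ^ 2 / δ ^ 2 + v := by
  obtain ⟨-, hloc, g, hg, heq⟩ := hu
  have hφ := isTestFunction_bump a hδ
  have hφc := hφ.1.continuous
  have hφ0 := bump_nonneg a δ
  have hu2 := hg.1.locallyIntegrable
  have huφ : Integrable (fun x => u x * bump a δ x) :=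
    hu2.integrable_smul_right_of_hasCompactSupport hφc hφ.2
  have hVuφ : Integrable (fun x => V x * u x * bump a δ x) := by
    have : Integrable (fun x => u x * (V x * bump a δ x)) :=
      hu2.integrable_smul_right_of_hasCompactSupport (hV.mul hφc) hφ.2.mul_left
    exact this.congr (.of_forall fun x => by ring)
  have hWuφ : Integrable (fun x => rieszConv N α 2 u x * u x * bump a δ x) := by
    have := hloc.integrable_smul_right_of_hasCompactSupport hφc hφ.2
    simpa using this
  have hgφ := integrable_inner_gradient hg.2.1 hφ
  have hLap := integrable_mul_divGradient hg.1 hφ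
  have hae : ∀ᵐ x : EuclideanSpace ℝ (Fin N), x ≠ a := by
    have : Nonempty (Fin N) := ⟨⟨0, hN⟩⟩
    exact compl_mem_ae_iff.2 (measure_singleton a)
  have hI : 0 < ∫ x, u x * bump a δ x := by
    rw [integral_pos_iff_support_of_nonneg_ae _ huφ]
    · refine (Metric.measure_ball_pos volume a hδ).trans_le (measure_mono_ae ?_)
      filter_upwards [hpos] with x hx hxb
      exact (mul_pos hx (bump_pos hxb)).ne'
    · filter_upwards [hpos] with x hx using mul_nonneg hx.le (hφ0 x)
  have hW : m * ∫ x, u x * bump a δ x ≤ ∫ x, rieszConv N α 2 u x * u x * bump a δ x := by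
    rw [← integral_const_mul]
    refine integral_mono_ae (huφ.const_mul m) hWuφ ?_
    filter_upwards [hpos, hm] with x hx hmx
    by_cases hxb : x ∈ Metric.ball a δ
    · have := mul_le_mul_of_nonneg_right (hmx hxb) (mul_nonneg hx.le (hφ0 x))
      simpa [mul_assoc] using this
    · simp [bump_eq_zero hδ hxb]
  have hVv : ∫ x, V x * u x * bump a δ x ≤ v * ∫ x, u x * bump a δ x := by
    rw [← integral_const_mul]
    refine integral_mono_ae hVuφ (huφ.const_mul v) ?_
    filter_upwards [hpos, hae] with x hx hxa
    by_cases hxb : x ∈ Metric.ball a δ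
    · have := mul_le_mul_of_nonneg_right (hv x hxb hxa) (mul_nonneg hx.le (hφ0 x))
      simpa [mul_assoc] using this
    · simp [bump_eq_zero hδ hxb]
  have hΔ : ∫ x, inner ℝ (g x) (∇ (bump a δ) x) ≤
      ((N : ℝ) + 5) ^ 2 / 2 / δ ^ 2 * ∫ x, u x * bump a δ x := by
    rw [hg.integral_inner_gradient hφ, ← integral_neg, ← integral_const_mul]
    refine integral_mono_ae hLap.neg (huφ.const_mul _) ?_
    filter_upwards [hpos] with x hx
    have := mul_le_mul_of_nonneg_left (neg_divGradient_bump_le a hδ x) hx.le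
    linarith
  have h := heq _ hφ
  rw [integral_add (hgφ.const_mul _) hVuφ, integral_const_mul] at h
  simp only [sub_self, Real.rpow_zero, one_mul] at h
  refine le_of_mul_le_mul_right ?_ hI
  calc ε ^ (-α) * m * ∫ x, u x * bump a δ x
      ≤ ε ^ (-α) * ∫ x, rieszConv N α 2 u x * u x * bump a δ x := by
        rw [mul_assoc]; gcongr
    _ ≤ ε ^ 2 * (((N : ℝ) + 5) ^ 2 / 2 / δ ^ 2 * ∫ x, u x * bump a δ x) +
          v * ∫ x, u x * bump a δ x := by
        rw [← h]; gcongr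
    _ = _ := by ring

end Choquard

/-! ### Decay of the mass away from `a` -/

theorem theorem1p4 (N : ℕ) (hN : 1 ≤ N) (α : ℝ) (hα : α ∈ Ioo (0 : ℝ) N)
    (hαN : (N : ℝ) - 2 < α)
    (V : EuclideanSpace ℝ (Fin N) → ℝ) (hVc : Continuous V) (hV0 : ∀ x, 0 ≤ V x)
    (a : EuclideanSpace ℝ (Fin N))
    (hVa : V =o[𝓝[≠] a] fun x => ‖x - a‖ ^ (4 / (α + 2 - N) - 2))
    (ε₀ : ℝ) (hε₀ : 0 < ε₀) (u : ℝ → EuclideanSpace ℝ (Fin N) → ℝ)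
    (huH : ∀ ε ∈ Ioo 0 ε₀, Choquard.MemH1loc (u ε))
    (huL : ∀ ε ∈ Ioo 0 ε₀, Choquard.MemWeightedL2 α (u ε))
    (hupos : ∀ ε ∈ Ioo 0 ε₀, ∀ᵐ x, 0 < u ε x)
    (husol : ∀ ε ∈ Ioo 0 ε₀, Choquard.IsWeakSolution V α 2 ε (u ε))
    (K : Set (EuclideanSpace ℝ (Fin N))) (hK : IsCompact K) (haK : a ∉ K) :
    (fun ε : ℝ => ∫ x in K, |u ε x| ^ 2) =o[𝓝[>] 0] fun ε : ℝ => ε ^ N := by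
  obtain ⟨d, hd, hdK⟩ : ∃ d > 0, Metric.ball a d ⊆ Kᶜ :=
    Metric.isOpen_iff.1 hK.isClosed.isOpen_compl a haK
  obtain ⟨R, hR⟩ := hK.isBounded.subset_closedBall a
  have hD : 0 < d + |R| := by positivity
  obtain ⟨c, hc, hcI⟩ := Choquard.exists_pos_forall_le_rieszPotential hα hD
  have hkernel : ∀ x ∈ Metric.ball a d, ∀ y ∈ K, c ≤ Choquard.rieszPotential N α (x - y) := by
    intro x hx y hy
    refine hcI _ (sub_ne_zero.2 fun hxy => hdK hx (hxy ▸ hy)) ?_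
    have h1 := mem_ball_iff_norm.1 hx
    have h2 := mem_closedBall_iff_norm.1 (hR hy)
    calc ‖x - y‖ = ‖(x - a) - (y - a)‖ := by congr 1; abel
      _ ≤ ‖x - a‖ + ‖y - a‖ := norm_sub_le _ _
      _ ≤ d + |R| := by linarith [le_abs_self R]
  set θ : ℝ := α + 2 - N with hθ
  have hθ0 : 0 < θ := by linarith
  have hθ2 : θ < 2 := by linarith [hα.2]
  set γ : ℝ := 4 / θ - 2 with hγ
  have hγ0 : 0 < γ := by
    rw [hγ, sub_pos, lt_div_iff₀ hθ0]; linarith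
  rw [isLittleO_iff]
  intro η hη
  set l : ℝ := ((N : ℝ) + 5) ^ 2 / 2 with hl
  have hl0 : 0 < l := by positivity
  -- `M` makes the kinetic term at scale `δ = M ε ^ (θ / 2)` at most half of `c η ε ^ (N - α)`.
  obtain ⟨M, hM, hMl⟩ : ∃ M : ℝ, 0 < M ∧ l / M ^ 2 = c * η / 2 := by
    refine ⟨√(2 * l / (c * η)), by positivity, ?_⟩
    rw [Real.sq_sqrt (by positivity)]
    field_simp
  -- `κ` does the same for the potential term.
  obtain ⟨κ, hκ, hκM⟩ : ∃ κ : ℝ, 0 < κ ∧ κ * M ^ γ = c * η / 2 :=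
    ⟨c * η / 2 / M ^ γ, by positivity, by field_simp⟩
  obtain ⟨r, hr, hrV⟩ : ∃ r > 0, ∀ x ∈ Metric.ball a r, x ≠ a → V x ≤ κ * ‖x - a‖ ^ γ := by
    have := isLittleO_iff.1 hVa hκ
    rw [eventually_nhdsWithin_iff, Metric.eventually_nhds_iff_ball] at this
    obtain ⟨r, hr, h⟩ := this
    refine ⟨r, hr, fun x hx hxa => ?_⟩
    have := h x hx hxa
    rwa [Real.norm_of_nonneg (hV0 x), Real.norm_of_nonneg (by positivity)] at this
  have hδlim : Tendsto (fun ε : ℝ => M * ε ^ (θ / 2)) (𝓝[>] 0) (𝓝 0) := by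
    have : ContinuousAt (fun ε : ℝ => M * ε ^ (θ / 2)) 0 :=
      continuousAt_const.mul (Real.continuousAt_rpow_const _ _ (.inr (by positivity)))
    have h := this.tendsto.mono_left (nhdsWithin_le_nhds (s := Ioi 0))
    rwa [Real.zero_rpow (by positivity), mul_zero] at h
  filter_upwards [hδlim.eventually (gt_mem_nhds (lt_min hd hr)), Ioo_mem_nhdsGT hε₀] with ε hεδ hε
  have hε0 : 0 < ε := hε.1
  set δ := M * ε ^ (θ / 2) with hδ
  have hδ0 : 0 < δ := by positivity
  have hsol := husol ε hε
  obtain ⟨hconv, -, g, hg, -⟩ := id hsol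
  have main := hsol.mul_le_of_forall_le (m := c * ∫ x in K, |u ε x| ^ 2) (v := κ * δ ^ γ)
    hN hVc hε0 (hupos ε hε) hδ0 (by
      filter_upwards [hconv] with x hx hxb
      exact Choquard.mul_setIntegral_le_rieszConv hα hg.1 hK (hkernel x
        (Metric.ball_subset_ball (hεδ.le.trans (min_le_left _ _)) hxb)) hx) (by
      intro x hxb hxa
      refine (hrV x (Metric.ball_subset_ball (hεδ.le.trans (min_le_right _ _)) hxb) hxa).trans ?_
      have := (mem_ball_iff_norm.1 hxb).le
      gcongr)
  -- Both terms on the right scale exactly like `ε ^ (N - α)`, which fixes the exponent `θ / 2`.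
  have hkin : l * ε ^ 2 / δ ^ 2 = c * η / 2 * ε ^ ((N : ℝ) - α) := by
    have h1 : δ ^ 2 = M ^ 2 * ε ^ θ := by
      rw [hδ, mul_pow, ← Real.rpow_natCast (ε ^ (θ / 2)), ← Real.rpow_mul hε0.le]
      norm_num
    have h2 : ε ^ ((N : ℝ) - α) = ε ^ 2 / ε ^ θ := by
      rw [← Real.rpow_two, ← Real.rpow_sub hε0, hθ]
      ring_nf
    rw [h1, h2, ← hMl]
    field_simp
  have hpot : κ * δ ^ γ = c * η / 2 * ε ^ ((N : ℝ) - α) := by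
    have h1 : θ / 2 * γ = (N : ℝ) - α := by
      rw [hγ]; field_simp; rw [hθ]; ring
    rw [hδ, Real.mul_rpow hM.le (by positivity), ← Real.rpow_mul hε0.le, h1, ← mul_assoc, hκM]
  rw [← hl, hkin, hpot] at main
  have hS : 0 ≤ ∫ x in K, |u ε x| ^ 2 := integral_nonneg fun x => by positivity
  rw [Real.norm_of_nonneg hS, Real.norm_of_nonneg (by positivity)]
  have hεN : ε ^ N = ε ^ α * ε ^ ((N : ℝ) - α) := by
    rw [← Real.rpow_natCast, ← Real.rpow_add hε0]; ring_nf
  refine le_of_mul_le_mul_left ?_ hc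
  calc c * ∫ x in K, |u ε x| ^ 2 = ε ^ α * (ε ^ (-α) * (c * ∫ x in K, |u ε x| ^ 2)) := by
        rw [← mul_assoc, ← Real.rpow_add hε0]; simp
    _ ≤ ε ^ α * (c * η / 2 * ε ^ ((N : ℝ) - α) + c * η / 2 * ε ^ ((N : ℝ) - α)) := by gcongr
    _ = c * (η * ε ^ N) := by rw [hεN]; ring
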